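/- Let $a,b\in\mathbb{C}$ with $ab\neq 0$, let $f(z)=ae^z+be^{-z}$ for $z\in\mathbb{C}$, and let $f^{\circ n}$ denote the $n$-th iterate of $f$ (with $f^{\circ 0}=\mathrm{id}$). Let $$I=\{z\in\mathbb{C} : |f^{\circ n}(z)|\to\infty \text{ as } n\to\infty\}$$ be the set of escaping points of $f$. For $p\in(1,\infty)$ and $\xi\in(0,\infty)$ let $$P_{p,\xi}=\{x+iy : x,y\in\mathbb{R},\ |x|>\xi,\ |y|<|x|^{1/p}\}$$ be the truncated $p$-parabola, and let $$I_{p,\xi}=\{z\in I : f^{\circ n}(z)\in P_{p,\xi}\text{ for all } n\geq 0\}.$$ Then for every $p\in(1,\infty)$ there is a $\xi_0>0$ (depending on $a$, $b$, $p$) such that for every $\xi\geq\xi_0$ the set $I_{p,\xi}$ has Hausdorff dimension at most $1+1/p$. -/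

import Mathlib

open Filter

/-- The entire map `f(z) = a e^z + b e^{-z}`. -/
noncomputable def expSumMap (a b : ℂ) (z : ℂ) : ℂ :=
  a * Complex.exp z + b * Complex.exp (-z)

/-- The set `I` of escaping points of `f`: those `z` with `|f^n(z)| → ∞` as `n → ∞`. -/
def escapingSet (f : ℂ → ℂ) : Set ℂ :=
  {z | Tendsto (fun n : ℕ => ‖f^[n] z‖) atTop atTop}

/-- The truncated `p`-parabola `{x + iy : |x| > ξ, |y| < |x|^(1/p)}`. -/
def truncatedParabola (p ξ : ℝ) : Set ℂ :=
  {z | ξ < |z.re| ∧ |z.im| < |z.re| ^ (1 / p)}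

/-- The escaping points of `f` whose whole orbit `z, f(z), f(f(z)), …` (including `z` itself)
lies in the truncated `p`-parabola. -/
def parabolaEscapingSet (f : ℂ → ℂ) (p ξ : ℝ) : Set ℂ :=
  {z | z ∈ escapingSet f ∧ ∀ n : ℕ, f^[n] z ∈ truncatedParabola p ξ}

open Metric Set MeasureTheory Topology
open scoped ENNReal NNReal

/-! Far from the imaginary axis one exponential dominates, so `f` expands near `w` by a factor of at
least `‖f w‖ / 8`. An inverse branch on a lattice cell in column `m` thus contracts by `O(1/|m|)`,
whichever cell it lands in. The parabola meets `O(|m|^(1/p))` cells of that column, so for `s > 1 +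
1/p` the `s`-th powers of the contractions are summable, and far out their sum is at most `1/2`.
Iterated pull-backs then give covers with `∑ diam^s ≤ 2⁻ⁿ`, hence zero `s`-measure. That truncation
depends on `s`, while `ξ₀` must not. Escaping orbits eventually pass any truncation, and pulling
back along `f` cell by cell does not raise dimension. -/

/-- Iterated covers by pull-backs under a map that expands between the cells `Q j`. -/
theorem exists_cover_of_expanding {X : Type*} [EMetricSpace X] {J : Type} [Countable J]
    {f : X → X} {A : Set X} {Q : J → Set X} {L : J → ℝ≥0∞} {s : ℝ} (hs : 0 < s)
    (hA : MapsTo f A A) (hcov : A ⊆ ⋃ j, Q j) (hQ : ∀ j, ediam (Q j) ≤ 1)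
    (hL : ∀ j, L j ≤ 2⁻¹) (hsum : ∑' j, L j ^ s ≤ 2⁻¹)
    (hf : ∀ i j z w, z ∈ Q i ∩ A → w ∈ Q i ∩ A → f z ∈ Q j → f w ∈ Q j →
      edist z w ≤ L j * edist (f z) (f w)) (n : ℕ) :
    ∀ i : J, ∃ (ι : Type) (_ : Countable ι) (U : ι → Set X), Q i ∩ A ⊆ ⋃ t, U t ∧
      (∀ t, ediam (U t) ≤ 2⁻¹ ^ n) ∧ ∑' t, ediam (U t) ^ s ≤ 2⁻¹ ^ n := by
  induction n with
  | zero =>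
    intro i
    refine ⟨Unit, inferInstance, fun _ => Q i, fun z hz => mem_iUnion.2 ⟨(), hz.1⟩, ?_, ?_⟩
    · simpa using hQ i
    · simpa using ENNReal.rpow_le_one (hQ i) hs.le
  | succ n ih =>
    intro i
    choose ι hι U hU hd hS using ih
    have key : ∀ j t, ediam (Q i ∩ A ∩ f ⁻¹' (Q j ∩ U j t)) ≤ L j * ediam (U j t) := by
      intro j t
      refine ediam_le fun z hz w hw => (hf i j z w hz.1 hw.1 hz.2.1 hw.2.1).trans ?_
      gcongr
      exact edist_le_ediam_of_mem hz.2.2 hw.2.2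
    refine ⟨Σ j, ι j, inferInstance, fun x => Q i ∩ A ∩ f ⁻¹' (Q x.1 ∩ U x.1 x.2), ?_, ?_, ?_⟩
    · intro z hz
      have hfz := hA hz.2
      obtain ⟨j, hj⟩ := mem_iUnion.1 (hcov hfz)
      obtain ⟨t, ht⟩ := mem_iUnion.1 (hU j ⟨hj, hfz⟩)
      exact mem_iUnion.2 ⟨⟨j, t⟩, hz, hj, ht⟩
    · rintro ⟨j, t⟩
      refine (key j t).trans ?_
      rw [pow_succ']
      exact mul_le_mul' (hL j) (hd j t)
    · calc ∑' x : Σ j, ι j, ediam (Q i ∩ A ∩ f ⁻¹' (Q x.1 ∩ U x.1 x.2)) ^ s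
          ≤ ∑' x : Σ j, ι j, L x.1 ^ s * ediam (U x.1 x.2) ^ s := by
            refine ENNReal.tsum_le_tsum fun x => ?_
            rw [← ENNReal.mul_rpow_of_nonneg _ _ hs.le]
            exact ENNReal.rpow_le_rpow (key _ _) hs.le
        _ = ∑' j, L j ^ s * ∑' t, ediam (U j t) ^ s := by
            rw [ENNReal.tsum_sigma']
            simp_rw [ENNReal.tsum_mul_left]
        _ ≤ ∑' j, L j ^ s * 2⁻¹ ^ n := ENNReal.tsum_le_tsum fun j => by gcongr; exact hS j
        _ = (∑' j, L j ^ s) * 2⁻¹ ^ n := ENNReal.tsum_mul_right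
        _ ≤ 2⁻¹ ^ (n + 1) := by rw [pow_succ']; gcongr

theorem hausdorffMeasure_eq_zero_of_expanding {X : Type*} [EMetricSpace X] [MeasurableSpace X]
    [BorelSpace X] {J : Type} [Countable J]
    {f : X → X} {A : Set X} {Q : J → Set X} {L : J → ℝ≥0∞} {s : ℝ} (hs : 0 < s)
    (hA : MapsTo f A A) (hcov : A ⊆ ⋃ j, Q j) (hQ : ∀ j, ediam (Q j) ≤ 1)
    (hL : ∀ j, L j ≤ 2⁻¹) (hsum : ∑' j, L j ^ s ≤ 2⁻¹)
    (hf : ∀ i j z w, z ∈ Q i ∩ A → w ∈ Q i ∩ A → f z ∈ Q j → f w ∈ Q j →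
      edist z w ≤ L j * edist (f z) (f w)) :
    μH[s] A = 0 := by
  have hzero : ∀ i, μH[s] (Q i ∩ A) = 0 := by
    intro i
    choose ι hι U hU hd hS using
      fun n => exists_cover_of_expanding hs hA hcov hQ hL hsum hf n i
    have h0 : Tendsto (fun n : ℕ => (2⁻¹ : ℝ≥0∞) ^ n) atTop (𝓝 0) :=
      ENNReal.tendsto_pow_atTop_nhds_zero_of_lt_one (by simp)
    have h1 := Measure.hausdorffMeasure_le_liminf_tsum s (Q i ∩ A) _ h0 U
      (Eventually.of_forall hd) (Eventually.of_forall hU)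
    have h2 : Tendsto (fun n => ∑' t, ediam (U n t) ^ s) atTop (𝓝 0) :=
      tendsto_of_tendsto_of_tendsto_of_le_of_le tendsto_const_nhds h0 (fun _ => zero_le) hS
    rw [h2.liminf_eq] at h1
    exact le_antisymm h1 zero_le
  refine measure_mono_null (t := ⋃ i, Q i ∩ A) ?_ (measure_iUnion_null hzero)
  intro z hz
  obtain ⟨j, hj⟩ := mem_iUnion.1 (hcov hz)
  exact mem_iUnion.2 ⟨j, hj, hz⟩

/-- A locally expanding map does not decrease the Hausdorff dimension. -/
theorem dimH_le_of_expanding_on {X Y : Type*} [EMetricSpace X] [EMetricSpace Y] {f : X → Y}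
    {S : Set X} {K : ℝ≥0} (hf : ∀ z ∈ S, ∀ w ∈ S, edist z w ≤ K * edist (f z) (f w)) :
    dimH S ≤ dimH (f '' S) := by
  have h : AntilipschitzWith K (fun x : S => f x) := fun z w => hf z z.2 w w.2
  have h1 := h.le_dimH_image univ
  have h2 := (isometry_subtype_coe (s := S)).dimH_image univ
  rw [image_univ, Subtype.range_coe] at h2
  rw [h2]
  convert h1 using 2
  ext y
  simp

/-! ### Lattice cells and expansion of the map -/

/-- The cells of the square lattice of mesh `1/4`. -/
def latticeCell (j : ℤ × ℤ) : Set ℂ := {z | ⌊4 * z.re⌋ = j.1 ∧ ⌊4 * z.im⌋ = j.2}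

theorem mem_latticeCell (z : ℂ) : z ∈ latticeCell (⌊4 * z.re⌋, ⌊4 * z.im⌋) := ⟨rfl, rfl⟩

theorem norm_sub_le_of_mem_latticeCell {j : ℤ × ℤ} {z w : ℂ} (hz : z ∈ latticeCell j)
    (hw : w ∈ latticeCell j) : ‖z - w‖ ≤ 1 / 2 := by
  have h1 := Int.abs_sub_lt_one_of_floor_eq_floor (hz.1.trans hw.1.symm)
  have h2 := Int.abs_sub_lt_one_of_floor_eq_floor (hz.2.trans hw.2.symm)
  have h3 := Complex.norm_le_abs_re_add_abs_im (z - w)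
  rw [Complex.sub_re, Complex.sub_im] at h3
  rw [← mul_sub, abs_mul, abs_of_pos (by norm_num : (0 : ℝ) < 4)] at h1 h2
  linarith

theorem ediam_latticeCell_le (j : ℤ × ℤ) : ediam (latticeCell j) ≤ 1 := by
  refine ediam_le fun z hz w hw => ?_
  rw [edist_dist, dist_eq_norm]
  exact ENNReal.ofReal_le_one.2 ((norm_sub_le_of_mem_latticeCell hz hw).trans (by norm_num))

/-- With `h = z - w`, the dominant term moves by at least `α‖h‖/2` and the other by at most `2β‖h‖`;
`8β ≤ α` leaves `α/4 ≥ (α + β)/8`. -/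
theorem norm_expSumMap_sub_ge_of_dominant {a b z w : ℂ}
    (hd : 8 * (‖b‖ * Real.exp (-w.re)) ≤ ‖a‖ * Real.exp w.re) (hzw : ‖z - w‖ ≤ 1 / 2) :
    ‖expSumMap a b w‖ / 8 * ‖z - w‖ ≤ ‖expSumMap a b z - expSumMap a b w‖ := by
  set h := z - w with hh
  have e1 : expSumMap a b z - expSumMap a b w =
      a * Complex.exp w * (Complex.exp h - 1) + b * Complex.exp (-w) * (Complex.exp (-h) - 1) := by
    have hz : z = w + h := by rw [hh]; ring
    rw [expSumMap, expSumMap, hz, neg_add, Complex.exp_add, Complex.exp_add]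
    ring
  have hn : ‖h‖ ^ 2 ≤ ‖h‖ / 2 := by nlinarith [norm_nonneg h]
  have l1 : ‖h‖ / 2 ≤ ‖Complex.exp h - 1‖ := by
    have k1 := Complex.norm_exp_sub_one_sub_id_le (x := h) (by linarith)
    have k2 := norm_sub_norm_le h (h - (Complex.exp h - 1))
    rw [sub_sub_cancel, norm_sub_rev h] at k2
    linarith
  have l2 : ‖Complex.exp (-h) - 1‖ ≤ 2 * ‖h‖ := by
    have k1 := Complex.norm_exp_sub_one_sub_id_le (x := -h) (by rw [norm_neg]; linarith)
    have k2 := norm_sub_norm_le (Complex.exp (-h) - 1) (-h)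
    rw [norm_neg] at k1 k2
    linarith [norm_nonneg h]
  have n1 : ‖a * Complex.exp w‖ = ‖a‖ * Real.exp w.re := by rw [norm_mul, Complex.norm_exp]
  have n2 : ‖b * Complex.exp (-w)‖ = ‖b‖ * Real.exp (-w.re) := by
    rw [norm_mul, Complex.norm_exp, Complex.neg_re]
  have n3 : ‖expSumMap a b w‖ ≤ ‖a‖ * Real.exp w.re + ‖b‖ * Real.exp (-w.re) := by
    rw [← n1, ← n2]; exact norm_add_le _ _
  have n4 : ‖a * Complex.exp w * (Complex.exp h - 1)‖
      - ‖b * Complex.exp (-w) * (Complex.exp (-h) - 1)‖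
      ≤ ‖expSumMap a b z - expSumMap a b w‖ := by
    rw [e1]; exact norm_sub_le_norm_add _ _
  rw [norm_mul, n1, norm_mul, n2] at n4
  set α := ‖a‖ * Real.exp w.re
  set β := ‖b‖ * Real.exp (-w.re)
  have hα : 0 ≤ α := by positivity
  have hβ : 0 ≤ β := by positivity
  have m1 : α * (‖h‖ / 2) ≤ α * ‖Complex.exp h - 1‖ := by gcongr
  have m2 : β * ‖Complex.exp (-h) - 1‖ ≤ β * (2 * ‖h‖) := by gcongr
  have m3 : ‖expSumMap a b w‖ / 8 * ‖h‖ ≤ (α + β) / 8 * ‖h‖ := by gcongr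
  have m4 : 8 * β * ‖h‖ ≤ α * ‖h‖ := by gcongr
  linarith [mul_nonneg hβ (norm_nonneg h)]

theorem expSumMap_neg (a b z : ℂ) : expSumMap a b (-z) = expSumMap b a z := by
  simp only [expSumMap, neg_neg]; ring

theorem exists_exp_dominant {a : ℂ} (b : ℂ) (ha : a ≠ 0) :
    ∃ R : ℝ, ∀ x, R < x → 8 * (‖b‖ * Real.exp (-x)) ≤ ‖a‖ * Real.exp x := by
  have ha' : 0 < ‖a‖ := norm_pos_iff.2 ha
  have h1 : Tendsto (fun x : ℝ => 8 * (‖b‖ * Real.exp (-x))) atTop (𝓝 (8 * (‖b‖ * 0))) :=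
    (Real.tendsto_exp_neg_atTop_nhds_zero.const_mul _).const_mul _
  have h2 : Tendsto (fun x : ℝ => ‖a‖ * Real.exp x) atTop atTop :=
    Real.tendsto_exp_atTop.const_mul_atTop ha'
  have h3 := (h1.eventually_lt_const (by simp : 8 * (‖b‖ * 0) < (1 : ℝ))).and
    (h2.eventually_ge_atTop 1)
  obtain ⟨R, hR⟩ := eventually_atTop.1 h3
  exact ⟨R, fun x hx => (hR x hx.le).1.le.trans (hR x hx.le).2⟩

theorem exists_norm_expSumMap_sub_ge {a b : ℂ} (hab : a * b ≠ 0) :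
    ∃ R : ℝ, ∀ z w : ℂ, R < |w.re| → ‖z - w‖ ≤ 1 / 2 →
      ‖expSumMap a b w‖ / 8 * ‖z - w‖ ≤ ‖expSumMap a b z - expSumMap a b w‖ := by
  obtain ⟨R₁, h₁⟩ := exists_exp_dominant b (left_ne_zero_of_mul hab)
  obtain ⟨R₂, h₂⟩ := exists_exp_dominant a (right_ne_zero_of_mul hab)
  refine ⟨max R₁ R₂, fun z w hw hzw => ?_⟩
  rcases lt_abs.1 hw with hw | hw
  · exact norm_expSumMap_sub_ge_of_dominant (h₁ _ ((le_max_left _ _).trans_lt hw)) hzw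
  -- The left half-plane reduces to the right one: `z ↦ -z` swaps `a` and `b`.
  · have := norm_expSumMap_sub_ge_of_dominant (a := b) (b := a) (z := -z) (w := -w)
      (by simpa using h₂ _ ((le_max_right _ _).trans_lt hw))
      (by rwa [← neg_sub', norm_neg])
    rwa [← neg_sub', norm_neg, expSumMap_neg, expSumMap_neg] at this

/-! ### Counting cells in the parabola -/

theorem summable_abs_int_add_one_rpow {r : ℝ} (hr : r < -1) :
    Summable fun m : ℤ => (|(m : ℝ)| + 1) ^ r := by
  have h := (summable_nat_add_iff 1).2 (Real.summable_nat_rpow.2 hr)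
  push_cast at h
  exact summable_int_iff_summable_nat_and_neg.2 ⟨by simpa using h, by simpa using h⟩

open Classical in
theorem tsum_int_ite_abs_le (r : ℝ) (hr : 0 ≤ r) (c : ℝ≥0∞) :
    ∑' k : ℤ, (if |(k : ℝ)| ≤ r then c else 0) ≤ ENNReal.ofReal (2 * r + 1) * c := by
  have hmem : ∀ k : ℤ, k ∉ Finset.Icc (-⌊r⌋) ⌊r⌋ → (if |(k : ℝ)| ≤ r then c else 0) = 0 := by
    intro k hk
    refine if_neg fun h => hk ?_
    rw [← Int.cast_abs, ← Int.le_floor] at h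
    exact Finset.mem_Icc.2 (abs_le.1 h)
  rw [tsum_eq_sum hmem]
  refine (Finset.sum_le_card_nsmul _ _ c fun k _ => by split_ifs <;> simp).trans ?_
  rw [nsmul_eq_mul]
  gcongr
  rw [Int.card_Icc, ← ENNReal.ofReal_natCast]
  refine ENNReal.ofReal_le_ofReal ?_
  have h0 : 0 ≤ ⌊r⌋ := Int.floor_nonneg.2 hr
  have h1 : (((⌊r⌋ + 1 - -⌊r⌋).toNat : ℤ) : ℝ) = 2 * ⌊r⌋ + 1 := by
    rw [Int.toNat_of_nonneg (by omega)]; push_cast; ring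
  rw [← Int.cast_natCast, h1]
  linarith [Int.floor_le r]

open Classical in
/-- The weight of a lattice cell lying in a parabola of exponent `q`, up to constants the `s`-th
power of the reciprocal distance to the origin. -/
noncomputable def cellWeight (q s : ℝ) (j : ℤ × ℤ) : ℝ≥0∞ :=
  if |(j.2 : ℝ)| ≤ 5 * (|(j.1 : ℝ)| + 1) ^ q then ENNReal.ofReal ((48 / (|(j.1 : ℝ)| + 1)) ^ s)
  else 0

theorem tsum_cellWeight_ne_top {q s : ℝ} (hq : 0 ≤ q) (hs : 1 + q < s) :
    ∑' j, cellWeight q s j ≠ ⊤ := by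
  have hsum := ((summable_abs_int_add_one_rpow (r := q - s) (by linarith)).mul_left
    (11 * 48 ^ s)).tsum_ofReal_ne_top
  refine ne_top_of_le_ne_top hsum ?_
  rw [ENNReal.tsum_prod (f := fun m k => cellWeight q s (m, k))]
  refine ENNReal.tsum_le_tsum fun m => ?_
  have hm : (0 : ℝ) < |(m : ℝ)| + 1 := by positivity
  have h1 : (1 : ℝ) ≤ (|(m : ℝ)| + 1) ^ q :=
    Real.one_le_rpow (by linarith [abs_nonneg (m : ℝ)]) hq
  refine (tsum_int_ite_abs_le (5 * (|(m : ℝ)| + 1) ^ q) (by positivity)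
    (ENNReal.ofReal ((48 / (|(m : ℝ)| + 1)) ^ s))).trans ?_
  rw [← ENNReal.ofReal_mul (by positivity)]
  refine ENNReal.ofReal_le_ofReal ?_
  rw [Real.div_rpow (by norm_num) hm.le, Real.rpow_sub hm]
  calc (2 * (5 * (|(m : ℝ)| + 1) ^ q) + 1) * (48 ^ s / (|(m : ℝ)| + 1) ^ s)
      ≤ (11 * (|(m : ℝ)| + 1) ^ q) * (48 ^ s / (|(m : ℝ)| + 1) ^ s) := by
        gcongr; linarith
    _ = _ := by ring

theorem abs_floor_sub_le (x : ℝ) : |(⌊x⌋ : ℝ) - x| ≤ 1 :=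
  abs_le.2 ⟨by linarith [Int.lt_floor_add_one x], by linarith [Int.floor_le x]⟩

theorem abs_index_le_of_mem_latticeCell {j : ℤ × ℤ} {z : ℂ} (hz : z ∈ latticeCell j) :
    |(j.1 : ℝ)| ≤ 4 * |z.re| + 1 ∧ 4 * |z.re| ≤ |(j.1 : ℝ)| + 1 ∧
      |(j.2 : ℝ)| ≤ 4 * |z.im| + 1 := by
  obtain ⟨h1, h2⟩ := hz
  have k1 := abs_floor_sub_le (4 * z.re)
  have k2 := abs_floor_sub_le (4 * z.im)
  rw [h1] at k1
  rw [h2] at k2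
  have e1 : |4 * z.re| = 4 * |z.re| := by rw [abs_mul, abs_of_pos (by norm_num : (0 : ℝ) < 4)]
  have e2 : |4 * z.im| = 4 * |z.im| := by rw [abs_mul, abs_of_pos (by norm_num : (0 : ℝ) < 4)]
  have t1 := abs_sub_abs_le_abs_sub (j.1 : ℝ) (4 * z.re)
  have t2 := abs_sub_abs_le_abs_sub (4 * z.re) (j.1 : ℝ)
  have t3 := abs_sub_abs_le_abs_sub (j.2 : ℝ) (4 * z.im)
  rw [abs_sub_comm] at t2
  exact ⟨by linarith, by linarith, by linarith⟩

theorem abs_im_index_le_of_mem {p ξ : ℝ} (hp : 0 < p) {j : ℤ × ℤ} {z : ℂ}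
    (hz : z ∈ latticeCell j) (hzP : z ∈ truncatedParabola p ξ) :
    |(j.2 : ℝ)| ≤ 5 * (|(j.1 : ℝ)| + 1) ^ (1 / p) := by
  obtain ⟨h1, h2, h3⟩ := abs_index_le_of_mem_latticeCell hz
  have hq : 0 ≤ 1 / p := by positivity
  have h4 : |z.re| ^ (1 / p) ≤ (|(j.1 : ℝ)| + 1) ^ (1 / p) :=
    Real.rpow_le_rpow (abs_nonneg _) (by linarith [abs_nonneg z.re]) hq
  have h5 : (1 : ℝ) ≤ (|(j.1 : ℝ)| + 1) ^ (1 / p) :=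
    Real.one_le_rpow (by linarith [abs_nonneg (j.1 : ℝ)]) hq
  linarith [hzP.2]

/-- The points whose whole orbit lies in the truncated parabola. -/
def parabolaOrbitSet (f : ℂ → ℂ) (p ξ : ℝ) : Set ℂ :=
  {z | ∀ n : ℕ, f^[n] z ∈ truncatedParabola p ξ}

open Classical in
theorem exists_hausdorffMeasure_parabolaOrbitSet_eq_zero {a b : ℂ} (hab : a * b ≠ 0) {p s : ℝ}
    (hp : 0 < p) (hs : 1 + 1 / p < s) :
    ∃ ξ : ℝ, μH[s] (parabolaOrbitSet (expSumMap a b) p ξ) = 0 := by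
  have hq : 0 ≤ 1 / p := by positivity
  have hs0 : 0 < s := by linarith
  obtain ⟨R, hR⟩ := exists_norm_expSumMap_sub_ge hab
  obtain ⟨F, hF⟩ := ((ENNReal.tendsto_tsum_compl_atTop_zero
    (tsum_cellWeight_ne_top hq hs)).eventually_le_const
      (by simp : (0 : ℝ≥0∞) < 2⁻¹)).exists
  obtain ⟨M, hM⟩ := (F.image fun j => |(j.1 : ℝ)| + 1).bddAbove
  -- `R` gives expansion, `24` makes every contraction at most `48/96`, and `M` keeps the relevant
  -- cells out of `F`, leaving only the small tail of the series.
  set ξ := max R (max 24 M) with hξdef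
  have hξR : R ≤ ξ := le_max_left _ _
  have hξ24 : 24 ≤ ξ := (le_max_left _ _).trans (le_max_right _ _)
  have hξM : M ≤ ξ := (le_max_right _ _).trans (le_max_right _ _)
  set f := expSumMap a b
  set A := parabolaOrbitSet f p ξ
  have hAP : ∀ z ∈ A, z ∈ truncatedParabola p ξ := fun z hz => hz 0
  have hAf : MapsTo f A A := fun z hz n => by
    rw [← Function.iterate_succ_apply]; exact hz (n + 1)
  let good : ℤ × ℤ → Prop := fun j => (latticeCell j ∩ truncatedParabola p ξ).Nonempty
  have hgood : ∀ j, good j → j ∉ F ∧ 96 ≤ |(j.1 : ℝ)| + 1 ∧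
      |(j.2 : ℝ)| ≤ 5 * (|(j.1 : ℝ)| + 1) ^ (1 / p) := by
    rintro j ⟨z, hz, hzP⟩
    have h2 := (abs_index_le_of_mem_latticeCell hz).2.1
    have h3 := hzP.1
    refine ⟨fun hj => ?_, by linarith, abs_im_index_le_of_mem hp hz hzP⟩
    have := hM (Finset.mem_coe.2 (Finset.mem_image_of_mem _ hj))
    linarith
  refine ⟨ξ, hausdorffMeasure_eq_zero_of_expanding (f := f) (Q := latticeCell)
    (L := fun j => if good j then ENNReal.ofReal (48 / (|(j.1 : ℝ)| + 1)) else 0) hs0 hAf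
    (fun z _ => mem_iUnion.2 ⟨_, mem_latticeCell z⟩) ediam_latticeCell_le ?_ ?_ ?_⟩
  · intro j
    split_ifs with h
    · rw [← ENNReal.ofReal_ofNat 2, ← ENNReal.ofReal_inv_of_pos two_pos]
      refine ENNReal.ofReal_le_ofReal ?_
      have := (hgood j h).2.1
      rw [div_le_iff₀ (by linarith)]
      linarith
    · exact zero_le
  · refine le_trans ?_ hF
    have hsupp : Function.support (fun j : ℤ × ℤ => (if good j then
        ENNReal.ofReal (48 / (|(j.1 : ℝ)| + 1)) else 0) ^ s) ⊆ {j | j ∉ F} := by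
      intro j hj hjF
      refine hj ?_
      have : ¬ good j := fun h => (hgood j h).1 hjF
      simp [this, hs0]
    rw [← tsum_subtype_eq_of_support_subset hsupp]
    refine ENNReal.tsum_le_tsum fun j => ?_
    split_ifs with h
    · rw [cellWeight, if_pos (hgood j h).2.2, ENNReal.ofReal_rpow_of_nonneg (by positivity) hs0.le]
    · simp [hs0]
  · intro i j z w hz hw hfz hfw
    have hfwP := hAP _ (hAf hw.2)
    rw [if_pos ⟨f w, hfw, hfwP⟩, edist_dist, edist_dist, dist_eq_norm, dist_eq_norm,
      ← ENNReal.ofReal_mul (by positivity)]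
    refine ENNReal.ofReal_le_ofReal ?_
    have key := hR z w (hξR.trans_lt (hAP w hw.2).1) (norm_sub_le_of_mem_latticeCell hz.1 hw.1)
    have h1 := (abs_index_le_of_mem_latticeCell hfw).1
    have h2 := hfwP.1
    -- `48 = 8 * 6`, as `|j.1| + 1 ≤ 4|Re f w| + 2 ≤ 6|Re f w|`.
    have h3 : (|(j.1 : ℝ)| + 1) / 48 ≤ ‖f w‖ / 8 := by
      linarith [Complex.abs_re_le_norm (f w)]
    have hpos : (0 : ℝ) < |(j.1 : ℝ)| + 1 := by positivity
    have h4 : (|(j.1 : ℝ)| + 1) / 48 * ‖z - w‖ ≤ ‖f z - f w‖ :=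
      (mul_le_mul_of_nonneg_right h3 (norm_nonneg _)).trans key
    calc ‖z - w‖ = 48 / (|(j.1 : ℝ)| + 1) * ((|(j.1 : ℝ)| + 1) / 48 * ‖z - w‖) := by
          field_simp
      _ ≤ _ := by gcongr

/-! ### Making the truncation independent of the exponent -/

/-- The points with orbit in the truncated parabola for `ξ`, and from time `k` on also in that for
`η`. -/
def eventualParabolaSet (f : ℂ → ℂ) (p ξ η : ℝ) (k : ℕ) : Set ℂ :=
  {z | z ∈ parabolaOrbitSet f p ξ ∧ f^[k] z ∈ parabolaOrbitSet f p η}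

theorem parabolaEscapingSet_subset {f : ℂ → ℂ} {p ξ : ℝ} (hp : 1 < p) (hξ : 1 ≤ ξ) (η : ℝ) :
    parabolaEscapingSet f p ξ ⊆ ⋃ k, eventualParabolaSet f p ξ η k := by
  rintro z ⟨hz, hzP⟩
  -- In the parabola `|Im| < |Re|`, so norm above `2η` forces `|Re| > η`.
  obtain ⟨k, hk⟩ := eventually_atTop.1 (Tendsto.eventually_gt_atTop hz (2 * η))
  refine mem_iUnion.2 ⟨k, hzP, fun n => ?_⟩
  rw [← Function.iterate_add_apply]
  have h1 := hk (n + k) (by omega)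
  have h2 := hzP (n + k)
  refine ⟨?_, h2.2⟩
  have h3 := Complex.norm_le_abs_re_add_abs_im (f^[n + k] z)
  have h4 : |(f^[n + k] z).re| ^ (1 / p) ≤ |(f^[n + k] z).re| := by
    refine (Real.rpow_le_rpow_of_exponent_le (by linarith [h2.1])
      ((div_le_one (by linarith)).2 hp.le)).trans_eq (Real.rpow_one _)
  linarith [h2.2]

theorem dimH_eventualParabolaSet_le {a b : ℂ} {p ξ η R : ℝ}
    (hR : ∀ z w : ℂ, R < |w.re| → ‖z - w‖ ≤ 1 / 2 →
      ‖expSumMap a b w‖ / 8 * ‖z - w‖ ≤ ‖expSumMap a b z - expSumMap a b w‖)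
    (hξR : R ≤ ξ) (hξ : 1 ≤ ξ) (k : ℕ) :
    dimH (eventualParabolaSet (expSumMap a b) p ξ η k) ≤
      dimH (parabolaOrbitSet (expSumMap a b) p η) := by
  set f := expSumMap a b
  induction k with
  | zero => exact dimH_mono fun z hz => hz.2
  | succ k ih =>
    set B := eventualParabolaSet f p ξ η (k + 1) with hB
    have hsub : B ⊆ ⋃ j, latticeCell j ∩ B :=
      fun z hz => mem_iUnion.2 ⟨_, mem_latticeCell z, hz⟩
    refine (dimH_mono hsub).trans ?_
    rw [dimH_iUnion]
    refine iSup_le fun j => ?_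
    -- Only a Lipschitz inverse on each cell is needed: `‖f w‖ ≥ 1` gives constant `8`.
    refine (dimH_le_of_expanding_on (f := f) (K := 8) ?_).trans ((dimH_mono ?_).trans ih)
    · intro z hz w hw
      have key := hR z w (hξR.trans_lt (hw.2.1 0).1) (norm_sub_le_of_mem_latticeCell hz.1 hw.1)
      have h1 : ξ < |(f w).re| := (hw.2.1 1).1
      have h2 : 1 ≤ ‖f w‖ := by linarith [Complex.abs_re_le_norm (f w)]
      rw [edist_dist, edist_dist, dist_eq_norm, dist_eq_norm,
        ← ENNReal.ofReal_coe_nnreal, ← ENNReal.ofReal_mul (by positivity)]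
      refine ENNReal.ofReal_le_ofReal ?_
      push_cast
      nlinarith [norm_nonneg (z - w)]
    · rintro _ ⟨z, ⟨-, hz⟩, rfl⟩
      refine ⟨fun n => ?_, ?_⟩
      · rw [← Function.iterate_succ_apply]; exact hz.1 (n + 1)
      · rw [← Function.iterate_succ_apply]; exact hz.2

theorem mainTheorem3 (a b : ℂ) (hab : a * b ≠ 0) (p : ℝ) (hp : 1 < p) :
    ∃ ξ₀ : ℝ, 0 < ξ₀ ∧ ∀ ξ : ℝ, ξ₀ ≤ ξ →
      dimH (parabolaEscapingSet (expSumMap a b) p ξ) ≤ ENNReal.ofReal (1 + 1 / p) := by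
  obtain ⟨R, hR⟩ := exists_norm_expSumMap_sub_ge hab
  refine ⟨max 1 R, by positivity, fun ξ hξ => ?_⟩
  have hξ1 : 1 ≤ ξ := (le_max_left _ _).trans hξ
  have hξR : R ≤ ξ := (le_max_right _ _).trans hξ
  refine ENNReal.le_of_forall_pos_le_add fun ε hε _ => ?_
  have hp0 : 0 < p := by linarith
  obtain ⟨η, hη⟩ := exists_hausdorffMeasure_parabolaOrbitSet_eq_zero hab hp0
    (s := 1 + 1 / p + ε) (by simpa using hε)
  have hdim : dimH (parabolaOrbitSet (expSumMap a b) p η) ≤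
      ENNReal.ofReal (1 + 1 / p) + ε := by
    have h0 : 0 ≤ 1 + 1 / p := by positivity
    have h1 : ((Real.toNNReal (1 + 1 / p) + ε : ℝ≥0) : ℝ) = 1 + 1 / p + ε := by
      rw [NNReal.coe_add, Real.coe_toNNReal _ h0]
    refine (dimH_le_of_hausdorffMeasure_ne_top (d := Real.toNNReal (1 + 1 / p) + ε) ?_).trans_eq ?_
    · rw [h1, hη]; exact ENNReal.zero_ne_top
    · rw [ENNReal.coe_add, ENNReal.ofReal]
  refine (dimH_mono (parabolaEscapingSet_subset hp hξ1 η)).trans ?_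
  rw [dimH_iUnion]
  exact iSup_le fun k => (dimH_eventualParabolaSet_le hR hξR hξ1 k).trans hdim
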